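/- Let $X=(X_s)_{s\ge 0}$ be a subordinator on a probability space (a process with $X_0=0$, stationary independent increments and almost surely non-decreasing right-continuous paths), with Laplace exponent $\Phi$ given by $\mathbb E[e^{-\lambda X_t}]=e^{-t\Phi(\lambda)}$ for $\lambda>0$, $t\ge 0$. For $\delta>0$ let $N(1,\delta)$ be the minimal number of intervals of length at most $\delta$ needed to cover the range $\{X_s: 0\le s\le 1\}$, and put $$f(x)=\frac{\ln|\ln x|}{\Phi\left(\frac{\ln|\ln x|}{x}\right)}\quad (0<x<e^{-1}),$$ with $f(0)=0$ for degenerate intervals. Assume that $$\lim_{x\to\infty}\frac{\Phi(x)\,\ln\ln x}{\Phi(x\ln\ln x)}=\infty .$$ Then, almost surely, the following holds. Let $(\mathcal A_\delta)_{0<\delta<1}$ be any family (which may depend on the path) such that each $\mathcal A_\delta$ is a finite or countable collection of intervals of length strictly less than $\delta$ covering $\{X_s:0\le s\le 1\}$, and such that $$\limsup_{\delta\to 0}\sum_{I\in\mathcal A_\delta}f(|I|)<\infty .$$ Then for every $c\in(0,1)$, $$\lim_{\delta\to 0}\frac{\#\{I\in\mathcal A_\delta:\ |I|>c\delta\}}{N(1,\delta)}=0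 .$$ -/

import Mathlib

open MeasureTheory ProbabilityTheory Filter Topology
open scoped NNReal ENNReal

namespace SubordinatorRange

/-- `X` is a (real-valued, unkilled) subordinator under `P`: a process started from `0` with
stationary and independent increments and almost surely non-decreasing, right-continuous paths.
Left limits exist automatically for non-decreasing paths. -/
structure IsSubordinator {Ω : Type*} [MeasurableSpace Ω] (X : ℝ≥0 → Ω → ℝ) (P : Measure Ω) :
    Prop where
  measurable : ∀ t, Measurable (X t)
  start_zero : ∀ᵐ ω ∂P, X 0 ω = 0
  mono : ∀ᵐ ω ∂P, Monotone fun t => X t ω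
  right_cont : ∀ᵐ ω ∂P, ∀ t, ContinuousWithinAt (fun s => X s ω) (Set.Ici t) t
  indep : HasIndepIncrements X P
  stationary : ∀ s t, IdentDistrib (fun ω => X (s + t) ω - X s ω) (X t) P P

/-- The Laplace (Lévy-Khintchine) exponent of a subordinator:
`E[exp(-lam * X_1)] = exp(-Φ(lam))` for `0 ≤ lam`. -/
noncomputable def laplaceExponent {Ω : Type*} [MeasurableSpace Ω] (X : ℝ≥0 → Ω → ℝ)
    (P : Measure Ω) (lam : ℝ) : ℝ :=
  -Real.log (∫ ω, Real.exp (-(lam * X 1 ω)) ∂P)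

/-- The range of the path `ω` of `X` up to time `t`, that is, `{X_s : 0 ≤ s ≤ t}`. -/
def rangeUpTo {Ω : Type*} (X : ℝ≥0 → Ω → ℝ) (t : ℝ≥0) (ω : Ω) : Set ℝ :=
  (fun s => X s ω) '' Set.Iic t

/-- `C` is an at most countable covering of `S` by intervals (of any kind: open, closed,
half-open). -/
structure IsIntervalCover (C : Set (Set ℝ)) (S : Set ℝ) : Prop where
  countable : C.Countable
  interval : ∀ I ∈ C, I.OrdConnected
  covers : S ⊆ ⋃₀ C

/-- The length of an interval, possibly infinite. -/
noncomputable def length (I : Set ℝ) : ℝ≥0∞ := Metric.ediam I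

/-- The minimal number of intervals of length at most `δ` that are needed to cover `S`. -/
noncomputable def coveringNumber (S : Set ℝ) (δ : ℝ) : ℕ∞ :=
  ⨅ C ∈ {C : Set (Set ℝ) | IsIntervalCover C S ∧ ∀ I ∈ C, length I ≤ ENNReal.ofReal δ}, C.encard

/-- `N(t, δ)`: the minimal number of intervals of length at most `δ` that are needed to cover the
range of `X` up to time `t`. -/
noncomputable def N {Ω : Type*} (X : ℝ≥0 → Ω → ℝ) (t : ℝ≥0) (δ : ℝ) (ω : Ω) : ℕ∞ :=
  coveringNumber (rangeUpTo X t ω) δ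

/-- The function `f(x) = ln|ln x| / Φ(ln|ln x| / x)`. -/
noncomputable def gauge (Φ : ℝ → ℝ) (x : ℝ) : ℝ :=
  Real.log |Real.log x| / Φ (Real.log |Real.log x| / x)

/-- The sum of `f(|I|)` over the intervals `I` of a collection, in `[0, ∞]`.
The terms are non-negative for all intervals of length below `exp (-1)`, so `ENNReal.ofReal`
changes nothing there. -/
noncomputable def gaugeSum (Φ : ℝ → ℝ) (C : Set (Set ℝ)) : ℝ≥0∞ :=
  ∑' I : C, ENNReal.ofReal (gauge Φ (length (I : Set ℝ)).toReal)

end SubordinatorRange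

/-! The argument compares both counts with `Φ(1/δ)`. Almost surely `N(1,δ) ≥ κ Φ(1/δ)` for small `δ`
(`IsSubordinator.ae_exists_le_N`): at a scale `1/x` with `Φ(x) = 2n`, most of the `n` increments
over time steps `1/n` exceed `1/x`, and Borel–Cantelli along `n = 2^j` makes this simultaneous in
`δ`. The regularity condition says that `f(x) Φ(1/x) → ∞` as `x → 0` (`eventually_lt_gauge_mul`).
Since `Φ(1/(cδ)) ≤ Φ(1/δ)/c`, each interval of length in `(cδ, δ)` contributes at least `M c /
Φ(1/δ)` to the gauge sum, with `M` arbitrarily large. A bounded sum leaves room for only `o(Φ(1/δ))`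
such intervals. -/

namespace SubordinatorRange

/-! ### Deterministic bounds on covering numbers. -/

section Covering

lemma coveringNumber_anti (S : Set ℝ) {δ δ' : ℝ} (h : δ ≤ δ') :
    coveringNumber S δ' ≤ coveringNumber S δ :=
  biInf_mono fun _ hC => ⟨hC.1, fun I hI => (hC.2 I hI).trans (ENNReal.ofReal_le_ofReal h)⟩

lemma one_le_coveringNumber {S : Set ℝ} (hS : S.Nonempty) (δ : ℝ) :
    1 ≤ coveringNumber S δ := by
  refine le_iInf₂ fun C hC => ?_
  obtain ⟨x, hx⟩ := hS
  obtain ⟨I, hI, -⟩ := hC.1.covers hx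
  exact Set.one_le_encard_iff_nonempty.2 ⟨I, hI⟩

/-- Large gaps of a monotone sequence of points of `S` have to be covered by distinct intervals. -/
lemma card_le_coveringNumber {S : Set ℝ} {δ : ℝ} (hδ : 0 ≤ δ) {p : ℕ → ℝ} (hp : Monotone p)
    (J : Finset ℕ) (hS : ∀ k ∈ J, p (k + 1) ∈ S) (hJ : ∀ k ∈ J, δ < p (k + 1) - p k) :
    (J.card : ℕ∞) ≤ coveringNumber S δ := by
  refine le_iInf₂ fun C hC => ?_
  have hcov : ∀ k ∈ J, ∃ I ∈ C, p (k + 1) ∈ I := fun k hk => by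
    obtain ⟨I, hI, h⟩ := hC.1.covers (hS k hk)
    exact ⟨I, hI, h⟩
  choose! F hFC hF using hcov
  -- The right endpoints are more than `δ` apart: the gap ending at `p (l + 1)` lies wholly to the
  -- right of `p (k + 1)`.
  have key : ∀ k ∈ J, ∀ l ∈ J, k < l → F k ≠ F l := by
    intro k hk l hl hkl heq
    have h1 : edist (p (l + 1)) (p (k + 1)) ≤ ENNReal.ofReal δ :=
      (Metric.edist_le_ediam_of_mem (hF l hl) (heq ▸ hF k hk)).trans (hC.2 _ (hFC l hl))
    have h2 : δ < p (l + 1) - p (k + 1) := by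
      have := hJ l hl
      have := hp (Nat.succ_le_of_lt hkl)
      simp only [Nat.succ_eq_add_one] at this
      linarith
    rw [edist_dist, Real.dist_eq, ENNReal.ofReal_le_ofReal_iff hδ] at h1
    linarith [le_abs_self (p (l + 1) - p (k + 1))]
  have hinj : Set.InjOn F (J : Set ℕ) := by
    intro k hk l hl h
    rcases lt_trichotomy k l with hkl | hkl | hkl
    · exact absurd h (key k hk l hl hkl)
    · exact hkl
    · exact absurd h.symm (key l hl k hk hkl)
  rw [← Set.encard_coe_eq_coe_finsetCard, ← hinj.encard_image]
  refine Set.encard_le_encard ?_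
  rintro _ ⟨k, hk, rfl⟩
  exact hFC k hk

end Covering

/-! ### A second-moment estimate. -/

section Counting

variable {Ω : Type*} [MeasurableSpace Ω] {P : Measure Ω} [IsProbabilityMeasure P]

/-- Chebyshev's inequality for the number of occurrences of independent events of probability at
most `3 / 8`. -/
lemma measure_half_le_count {Y : ℕ → Ω → ℝ} (hY : ∀ k, Measurable (Y k)) (hind : iIndepFun Y P)
    {E : Set ℝ} (hE : MeasurableSet E) (hp : ∀ k, P.real (Y k ⁻¹' E) ≤ 3 / 8) {n : ℕ}
    (hn : 0 < n) :
    P {ω | (n : ℝ) / 2 ≤ ∑ k ∈ Finset.range n, E.indicator (fun _ => (1 : ℝ)) (Y k ω)} ≤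
      ENNReal.ofReal (64 / n) := by
  set g : ℝ → ℝ := E.indicator fun _ => (1 : ℝ) with hg
  have hgm : Measurable g := measurable_const.indicator hE
  have hg1 : ∀ x, ‖g x‖ ≤ 1 := fun x => by
    by_cases hx : x ∈ E <;> simp [hg, hx]
  have hn' : (0 : ℝ) < n := by exact_mod_cast hn
  set Z : ℕ → Ω → ℝ := fun k => g ∘ Y k with hZ
  have hZm : ∀ k, Measurable (Z k) := fun k => hgm.comp (hY k)
  have hZL : ∀ k, MemLp (Z k) 2 P := fun k =>
    MemLp.of_bound (hZm k).aestronglyMeasurable 1 (ae_of_all _ fun ω => hg1 _)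
  have hZind : iIndepFun Z P := hind.comp (fun _ => g) fun _ => hgm
  have hZint : ∀ k, ∫ ω, Z k ω ∂P ≤ 3 / 8 := fun k => by
    have : Z k = (Y k ⁻¹' E).indicator 1 := by
      ext ω; by_cases h : Y k ω ∈ E <;> simp [hZ, hg, h]
    rw [this, integral_indicator_one (hY k hE)]
    exact hp k
  set W : Ω → ℝ := ∑ k ∈ Finset.range n, Z k with hW
  have hWL : MemLp W 2 P := memLp_finsetSum' _ fun k _ => hZL k
  have hvar : variance W P ≤ n := by
    rw [hW, IndepFun.variance_sum (fun k _ => hZL k) fun i _ j _ hij => hZind.indepFun hij]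
    calc ∑ k ∈ Finset.range n, variance (Z k) P ≤ ∑ k ∈ Finset.range n, (1 : ℝ) := by
          refine Finset.sum_le_sum fun k _ => ?_
          refine (variance_le_expectation_sq (hZm k).aestronglyMeasurable).trans ?_
          calc ∫ ω, (Z k ^ 2) ω ∂P ≤ ∫ _, (1 : ℝ) ∂P := by
                refine integral_mono (hZL k).integrable_sq (integrable_const _) fun ω => ?_
                have := hg1 (Y k ω)
                simp only [hZ, Pi.pow_apply, Function.comp_apply]
                rw [Real.norm_eq_abs] at this
                exact (sq_le_one_iff_abs_le_one _).2 this
            _ = 1 := by simp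
      _ = n := by simp
  have hmean : ∫ ω, W ω ∂P ≤ n * (3 / 8) := by
    simp only [hW, Finset.sum_apply]
    rw [integral_finsetSum _ fun k _ => (hZL k).integrable one_le_two]
    calc ∑ k ∈ Finset.range n, ∫ ω, Z k ω ∂P ≤ ∑ k ∈ Finset.range n, (3 / 8 : ℝ) :=
          Finset.sum_le_sum fun k _ => hZint k
      _ = n * (3 / 8) := by simp
  -- Mean at most `3n/8` forces a deviation of `n/8`; variance at most `n` then gives `n / (n/8)^2 =
  -- 64/n`.
  calc P {ω | (n : ℝ) / 2 ≤ ∑ k ∈ Finset.range n, g (Y k ω)}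
      ≤ P {ω | (n : ℝ) / 8 ≤ |W ω - ∫ ω, W ω ∂P|} := by
        refine measure_mono fun ω hω => ?_
        have h : (n : ℝ) / 2 ≤ W ω := by simpa [hW, hZ] using hω
        have h' : (n : ℝ) / 8 ≤ W ω - ∫ ω, W ω ∂P := by linarith
        exact h'.trans (le_abs_self _)
    _ ≤ ENNReal.ofReal (variance W P / (n / 8) ^ 2) :=
        meas_ge_le_variance_div_sq hWL (by positivity)
    _ ≤ ENNReal.ofReal (64 / n) := by
        refine ENNReal.ofReal_le_ofReal ?_
        rw [div_le_div_iff₀ (by positivity) hn']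
        nlinarith

end Counting

/-! ### The Laplace exponent and the almost sure lower bound for `N(1,δ)`. -/

section Exponent

variable {Ω : Type*} [MeasurableSpace Ω] {P : Measure Ω} {X : ℝ≥0 → Ω → ℝ}

lemma IsSubordinator.ae_nonneg (hX : IsSubordinator X P) (t : ℝ≥0) : ∀ᵐ ω ∂P, 0 ≤ X t ω := by
  filter_upwards [hX.start_zero, hX.mono] with ω h0 hm
  exact h0 ▸ hm (zero_le (a := t))

lemma IsSubordinator.exp_le_one (hX : IsSubordinator X P) (t : ℝ≥0) {x : ℝ} (hx : 0 ≤ x) :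
    ∀ᵐ ω ∂P, Real.exp (-x * X t ω) ≤ 1 := by
  filter_upwards [hX.ae_nonneg t] with ω h
  rw [Real.exp_le_one_iff]
  nlinarith

lemma laplaceExponent_eq (x : ℝ) : laplaceExponent X P x = -Real.log (mgf (X 1) P (-x)) := by
  simp [laplaceExponent, mgf]

/-- The increments of `X` over the intervals `[k / n, (k + 1) / n]`. -/
noncomputable def gridIncrement (X : ℝ≥0 → Ω → ℝ) (n k : ℕ) (ω : Ω) : ℝ :=
  X (((k + 1 : ℕ) : ℝ≥0) / n) ω - X ((k : ℝ≥0) / n) ω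

lemma monotone_grid (n : ℕ) : Monotone fun k : ℕ => (k : ℝ≥0) / n := fun k l h => by
  dsimp only
  gcongr

lemma IsSubordinator.measurable_gridIncrement (hX : IsSubordinator X P) (n k : ℕ) :
    Measurable (gridIncrement X n k) :=
  (hX.measurable _).sub (hX.measurable _)

lemma IsSubordinator.iIndepFun_gridIncrement (hX : IsSubordinator X P) (n : ℕ) :
    iIndepFun (gridIncrement X n) P :=
  hX.indep.nat (monotone_grid n)

lemma IsSubordinator.identDistrib_gridIncrement (hX : IsSubordinator X P) (n k : ℕ) :
    IdentDistrib (gridIncrement X n k) (X (1 / n)) P P := by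
  have h := hX.stationary ((k : ℝ≥0) / n) (1 / n)
  rw [← add_div] at h
  have heq : gridIncrement X n k =
      fun ω => X (((k : ℝ≥0) + 1) / n) ω - X ((k : ℝ≥0) / n) ω := by
    ext ω
    simp [gridIncrement]
  rwa [heq]

variable [IsProbabilityMeasure P]

lemma IsSubordinator.integrable_exp (hX : IsSubordinator X P) (t : ℝ≥0) {x : ℝ} (hx : 0 ≤ x) :
    Integrable (fun ω => Real.exp (-x * X t ω)) P := by
  refine Integrable.of_bound
    ((hX.measurable t).const_mul _).exp.aestronglyMeasurable 1 ?_
  filter_upwards [hX.exp_le_one t hx] with ω h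
  rwa [Real.norm_eq_abs, Real.abs_exp]

lemma IsSubordinator.mgf_one (hX : IsSubordinator X P) {x : ℝ} (hx : 0 ≤ x) :
    mgf (X 1) P (-x) = Real.exp (-laplaceExponent X P x) := by
  rw [laplaceExponent_eq, neg_neg, Real.exp_log (mgf_pos (hX.integrable_exp 1 hx))]

lemma IsSubordinator.laplaceExponent_nonneg (hX : IsSubordinator X P) {x : ℝ} (hx : 0 ≤ x) :
    0 ≤ laplaceExponent X P x := by
  have h : mgf (X 1) P (-x) ≤ 1 := by
    calc mgf (X 1) P (-x) ≤ ∫ _, (1 : ℝ) ∂P :=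
          integral_mono_ae (hX.integrable_exp 1 hx) (integrable_const _) (hX.exp_le_one 1 hx)
      _ = 1 := by simp
  rw [hX.mgf_one hx, Real.exp_le_one_iff] at h
  linarith

lemma IsSubordinator.laplaceExponent_mono (hX : IsSubordinator X P) {x y : ℝ} (hx : 0 ≤ x)
    (hxy : x ≤ y) : laplaceExponent X P x ≤ laplaceExponent X P y := by
  have h : mgf (X 1) P (-y) ≤ mgf (X 1) P (-x) := by
    refine integral_mono_ae (hX.integrable_exp 1 (hx.trans hxy)) (hX.integrable_exp 1 hx) ?_
    filter_upwards [hX.ae_nonneg 1] with ω h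
    exact Real.exp_le_exp.2 (by nlinarith)
  rw [hX.mgf_one hx, hX.mgf_one (hx.trans hxy), Real.exp_le_exp] at h
  linarith

/-- Jensen's inequality for the Laplace exponent. -/
lemma IsSubordinator.laplaceExponent_mul_le (hX : IsSubordinator X P) {x r : ℝ} (hx : 0 ≤ x)
    (hr : 1 ≤ r) : laplaceExponent X P (r * x) ≤ r * laplaceExponent X P x := by
  have hr0 : 0 ≤ r := zero_le_one.trans hr
  have hpow : ∀ ω, Real.exp (-x * X 1 ω) ^ r = Real.exp (-(r * x) * X 1 ω) := fun ω => by
    rw [← Real.exp_mul]; ring_nf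
  have h : mgf (X 1) P (-x) ^ r ≤ mgf (X 1) P (-(r * x)) := by
    have := (convexOn_rpow hr).map_integral_le (μ := P)
      (f := fun ω => Real.exp (-x * X 1 ω))
      (Real.continuous_rpow_const hr0).continuousOn isClosed_Ici
      (ae_of_all _ fun ω => (Real.exp_pos _).le) (hX.integrable_exp 1 hx)
      (by
        simp only [Function.comp_def, hpow]
        exact hX.integrable_exp 1 (by positivity))
    simpa only [hpow, mgf] using this
  rw [hX.mgf_one hx, hX.mgf_one (by positivity), ← Real.exp_mul, Real.exp_le_exp] at h
  linarith

lemma IsSubordinator.continuousOn_laplaceExponent (hX : IsSubordinator X P) :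
    ContinuousOn (laplaceExponent X P) (Set.Ici 0) := by
  have hmgf : ContinuousOn (fun x => mgf (X 1) P (-x)) (Set.Ici 0) := by
    refine continuousOn_of_dominated (bound := fun _ => 1)
      (fun x _ => ((hX.measurable 1).const_mul _).exp.aestronglyMeasurable) (fun x hx => ?_)
      (integrable_const _) (ae_of_all _ fun ω => by fun_prop)
    filter_upwards [hX.exp_le_one 1 hx] with ω h
    rwa [Real.norm_eq_abs, Real.abs_exp]
  have heq : laplaceExponent X P = fun x => -Real.log (mgf (X 1) P (-x)) :=
    funext laplaceExponent_eq
  rw [heq]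
  exact (hmgf.log fun x hx => (mgf_pos (hX.integrable_exp 1 hx)).ne').neg

/-- An unbounded Laplace exponent takes every non-negative value. -/
lemma IsSubordinator.exists_laplaceExponent_eq (hX : IsSubordinator X P)
    (hub : ∀ b : ℝ, ∃ x, 0 ≤ x ∧ b < laplaceExponent X P x) {v : ℝ} (hv : 0 < v) :
    ∃ x, 0 < x ∧ laplaceExponent X P x = v := by
  obtain ⟨y, hy, hyv⟩ := hub v
  have h0 : laplaceExponent X P 0 = 0 := by simp [laplaceExponent]
  obtain ⟨x, hx, hxv⟩ := intermediate_value_Icc hy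
    (hX.continuousOn_laplaceExponent.mono Set.Icc_subset_Ici_self)
    (show v ∈ Set.Icc _ _ from ⟨h0.trans_le hv.le, hyv.le⟩)
  refine ⟨x, hx.1.lt_of_ne ?_, hxv⟩
  rintro rfl
  exact hv.ne (h0.symm.trans hxv)

/-- `X 1` is a.s. a sum of `n` independent copies of `X (1 / n)`, so this is a positive `n`-th root.
Only times `1/n` are needed, which avoids the formula at general `t`. -/
lemma IsSubordinator.mgf_grid (hX : IsSubordinator X P) {n : ℕ} (hn : 0 < n) {x : ℝ}
    (hx : 0 ≤ x) : mgf (X (1 / n)) P (-x) = Real.exp (-laplaceExponent X P x / n) := by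
  have hn' : (n : ℝ≥0) ≠ 0 := by exact_mod_cast hn.ne'
  have hsum : X 1 =ᵐ[P] ∑ k ∈ Finset.range n, gridIncrement X n k := by
    filter_upwards [hX.start_zero] with ω h0
    have := Finset.sum_range_sub (fun k : ℕ => X ((k : ℝ≥0) / n) ω) n
    simp only [Finset.sum_apply, gridIncrement]
    rw [this, div_self hn']
    simp [h0]
  have hpow : Real.exp (-laplaceExponent X P x) = mgf (X (1 / n)) P (-x) ^ n := by
    rw [← hX.mgf_one hx, mgf_congr hsum,
      (hX.iIndepFun_gridIncrement n).mgf_sum (hX.measurable_gridIncrement n),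
      Finset.prod_congr rfl fun k _ => mgf_congr_of_identDistrib _ _
        (hX.identDistrib_gridIncrement n k) (-x)]
    simp
  have hn0 : (n : ℝ) ≠ 0 := by exact_mod_cast hn.ne'
  refine (pow_left_inj₀ mgf_nonneg (Real.exp_pos _).le hn.ne').1 ?_
  rw [← hpow, ← Real.exp_nat_mul]
  congr 1
  field_simp

/-- If `Φ(x) = 2 n`, then an increment over a time interval of length `1 / n` exceeds `1 / x` with
probability at least `5 / 8`. -/
lemma IsSubordinator.measure_gridIncrement_le (hX : IsSubordinator X P) {n : ℕ} (hn : 0 < n)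
    {x : ℝ} (hx : 0 < x) (hΦ : laplaceExponent X P x = 2 * n) (k : ℕ) :
    P.real (gridIncrement X n k ⁻¹' Set.Iic (1 / x)) ≤ 3 / 8 := by
  have hn0 : (n : ℝ) ≠ 0 := by exact_mod_cast hn.ne'
  have h1 : P.real (gridIncrement X n k ⁻¹' Set.Iic (1 / x)) =
      P.real {ω | X (1 / n) ω ≤ 1 / x} := by
    rw [measureReal_def, measureReal_def,
      (hX.identDistrib_gridIncrement n k).measure_mem_eq measurableSet_Iic]
    rfl
  rw [h1]
  calc P.real {ω | X (1 / n) ω ≤ 1 / x}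
      ≤ Real.exp (- -x * (1 / x)) * mgf (X (1 / n)) P (-x) :=
        measure_le_le_exp_mul_mgf _ (by linarith) (hX.integrable_exp _ hx.le)
    _ = Real.exp (-1) := by
        rw [hX.mgf_grid hn hx.le, ← Real.exp_add, hΦ]
        congr 1
        field_simp
        norm_num
    _ ≤ 3 / 8 := by linarith [Real.exp_neg_one_lt_d9]

/-- The covering number at scale `1 / x`, where `Φ(x) = 2 n`, is at least `n / 2` with high
probability. -/
lemma IsSubordinator.measure_le_of_half_le_N (hX : IsSubordinator X P) {n : ℕ} (hn : 0 < n)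
    {x : ℝ} (hx : 0 < x) (hΦ : laplaceExponent X P x = 2 * n) :
    ∃ B : Set Ω, P B ≤ ENNReal.ofReal (64 / n) ∧ ∀ ω ∉ B, (Monotone fun t => X t ω) →
      ENNReal.ofReal (n / 2) ≤ ((N X 1 (1 / x) ω : ℕ∞) : ℝ≥0∞) := by
  refine ⟨_, measure_half_le_count (hX.measurable_gridIncrement n) (hX.iIndepFun_gridIncrement n)
    measurableSet_Iic (hX.measure_gridIncrement_le hn hx hΦ) hn, fun ω hω hm => ?_⟩
  have hn' : (n : ℝ≥0) ≠ 0 := by exact_mod_cast hn.ne'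
  set J := (Finset.range n).filter fun k => 1 / x < gridIncrement X n k ω with hJ
  have hcount : ∑ k ∈ Finset.range n,
      (Set.Iic (1 / x)).indicator (fun _ => (1 : ℝ)) (gridIncrement X n k ω) = n - J.card := by
    have hpt : ∀ k, (Set.Iic (1 / x)).indicator (fun _ => (1 : ℝ)) (gridIncrement X n k ω) =
        1 - if 1 / x < gridIncrement X n k ω then 1 else 0 := fun k => by
      by_cases h : 1 / x < gridIncrement X n k ω
      · rw [Set.indicator_of_notMem (by simpa using h), if_pos h]; norm_num
      · rw [Set.indicator_of_mem (by simpa using h), if_neg h]; norm_num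
    simp_rw [hpt]
    rw [Finset.sum_sub_distrib, Finset.sum_boole]
    simp [hJ]
  have hcard : (n : ℝ) / 2 ≤ J.card := by
    simp only [Set.mem_ofPred_eq, not_le, hcount] at hω
    linarith
  have hN : (J.card : ℕ∞) ≤ N X 1 (1 / x) ω := by
    refine card_le_coveringNumber (p := fun k => X ((k : ℝ≥0) / n) ω) (by positivity)
      (hm.comp (monotone_grid n)) J (fun k hk => ?_) fun k hk => (Finset.mem_filter.1 hk).2
    refine ⟨_, ?_, rfl⟩
    have hk' : k + 1 ≤ n := Finset.mem_range.1 (Finset.mem_filter.1 hk).1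
    simp only [Set.mem_Iic]
    exact div_le_one_of_le₀ (by exact_mod_cast hk') (zero_le)
  calc ENNReal.ofReal (n / 2) ≤ ENNReal.ofReal J.card := ENNReal.ofReal_le_ofReal hcard
    _ = (((J.card : ℕ∞)) : ℝ≥0∞) := by simp
    _ ≤ _ := ENat.toENNReal_le.2 hN

/-- Almost surely, the covering number `N(1, δ)` is at least of the order `Φ(1 / δ)`. -/
theorem IsSubordinator.ae_exists_le_N (hX : IsSubordinator X P) :
    ∀ᵐ ω ∂P, ∃ κ : ℝ, 0 < κ ∧ ∀ᶠ δ in 𝓝[>] (0 : ℝ),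
      ENNReal.ofReal (κ * laplaceExponent X P (1 / δ)) ≤ ((N X 1 δ ω : ℕ∞) : ℝ≥0∞) := by
  by_cases hub : ∀ b : ℝ, ∃ x, 0 ≤ x ∧ b < laplaceExponent X P x
  -- Scales `1 / x j` with `Φ(x j) = 2 · 2^j`, so that the error bounds `64 / 2^j` are summable.
  · have hpos : ∀ j : ℕ, (0 : ℝ) < 2 * (2 ^ j : ℕ) := fun j => by positivity
    choose x hx hxΦ using fun j => hX.exists_laplaceExponent_eq hub (hpos j)
    choose B hB hBN using fun j => hX.measure_le_of_half_le_N (n := 2 ^ j) (by positivity)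
      (hx j) (hxΦ j)
    have hsum : ∑' j, P (B j) ≠ ∞ := by
      refine ne_top_of_le_ne_top ?_ (ENNReal.tsum_le_tsum hB)
      have hs : Summable fun j : ℕ => 64 / ((2 ^ j : ℕ) : ℝ) := by
        simpa [div_eq_mul_inv] using
          (summable_geometric_of_lt_one (r := (2⁻¹ : ℝ)) (by norm_num) (by norm_num)).mul_left 64
      exact hs.tsum_ofReal_ne_top
    filter_upwards [ae_eventually_notMem hsum, hX.mono] with ω hω hm
    refine ⟨1 / 16, by norm_num, ?_⟩
    obtain ⟨j₀, hj₀⟩ := eventually_atTop.1 hω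
    -- Beyond `y`, `v / 4 > 2^j₀`, which puts the index `j` chosen below past the Borel–Cantelli
    -- threshold.
    obtain ⟨y, hy, hyΦ⟩ := hub (4 * 2 ^ j₀)
    have hsmall : Set.Ioo (0 : ℝ) (1 / (y + 1)) ∈ 𝓝[>] (0 : ℝ) :=
      Ioo_mem_nhdsGT (by positivity)
    filter_upwards [hsmall] with δ hδ
    have hδ0 : 0 < δ := hδ.1
    have hyδ : y ≤ 1 / δ := by
      have := (lt_div_iff₀ (by positivity)).1 hδ.2
      rw [le_div_iff₀ hδ0]
      nlinarith
    set v := laplaceExponent X P (1 / δ) with hv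
    have hv4 : (2 : ℝ) ^ j₀ < v / 4 := by
      have := hX.laplaceExponent_mono hy hyδ
      linarith
    -- With `2^j ≤ v/4 < 2^(j+1)`, the lower bound gives `δ ≤ 1 / x j`, and the upper bound gives
    -- `2^j / 2 ≥ v/16`, whence `κ = 1/16`.
    obtain ⟨j, hj, hj'⟩ := exists_nat_pow_near
      ((one_le_pow₀ (one_le_two (α := ℝ)) : (1 : ℝ) ≤ 2 ^ j₀).trans hv4.le) one_lt_two
    have hjj : j₀ ≤ j := by
      have := (pow_lt_pow_iff_right₀ (one_lt_two (α := ℝ))).1 (hv4.trans hj')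
      omega
    have hxδ : x j ≤ 1 / δ := by
      by_contra! h
      have h1 := hX.laplaceExponent_mono (by positivity) h.le
      rw [hxΦ j, ← hv] at h1
      push_cast at h1
      have : (0 : ℝ) < 2 ^ j := by positivity
      linarith
    have hδx : δ ≤ 1 / x j := by
      rw [le_div_iff₀ (hx j)]
      rw [le_div_iff₀ hδ0] at hxδ
      linarith
    calc ENNReal.ofReal (1 / 16 * v) ≤ ENNReal.ofReal ((2 ^ j : ℕ) / 2) := by
          refine ENNReal.ofReal_le_ofReal ?_
          push_cast
          rw [pow_succ] at hj'
          linarith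
      _ ≤ ((N X 1 (1 / x j) ω : ℕ∞) : ℝ≥0∞) := hBN j ω (hj₀ j hjj) hm
      _ ≤ ((N X 1 δ ω : ℕ∞) : ℝ≥0∞) := ENat.toENNReal_le.2 (coveringNumber_anti _ hδx)
  -- For bounded `Φ` the trivial bound `N ≥ 1` suffices.
  · push Not at hub
    obtain ⟨b, hb⟩ := hub
    refine ae_of_all _ fun ω => ⟨1 / (|b| + 1), by positivity, ?_⟩
    filter_upwards [self_mem_nhdsWithin] with δ hδ
    have hδ0 : 0 < δ := hδ
    have h1 : (1 : ℕ∞) ≤ N X 1 δ ω :=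
      one_le_coveringNumber (S := rangeUpTo X 1 ω) (Set.nonempty_Iic.image _) δ
    calc ENNReal.ofReal (1 / (|b| + 1) * laplaceExponent X P (1 / δ)) ≤ ENNReal.ofReal 1 := by
          refine ENNReal.ofReal_le_ofReal ?_
          have h2 := hb (1 / δ) (by positivity)
          rw [one_div_mul_eq_div, div_le_one (by positivity)]
          linarith [le_abs_self b]
      _ = ((1 : ℕ∞) : ℝ≥0∞) := by simp
      _ ≤ _ := ENat.toENNReal_le.2 h1

end Exponent

/-! ### The gauge function and the regularity condition. -/

section Gauge

/-- The product `f(x) Φ(1 / x)` is the ratio in the regularity condition, taken at `1 / x`. -/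
lemma gauge_mul_eq (Φ : ℝ → ℝ) {x : ℝ} (hx0 : 0 < x) (hx1 : x < 1) :
    gauge Φ x * Φ (1 / x) = Φ (1 / x) * Real.log (Real.log (1 / x)) /
      Φ (1 / x * Real.log (Real.log (1 / x))) := by
  have h : |Real.log x| = Real.log (1 / x) := by
    rw [abs_of_neg (Real.log_neg hx0 hx1), one_div, Real.log_inv]
  rw [gauge, h, one_div_mul_eq_div, mul_comm, mul_div_assoc]

lemma eventually_lt_gauge_mul {Φ : ℝ → ℝ}
    (hΦ : Tendsto (fun x : ℝ => Φ x * Real.log (Real.log x) / Φ (x * Real.log (Real.log x)))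
      atTop atTop) (M : ℝ) :
    ∃ η > 0, ∀ x, 0 < x → x < η → M < gauge Φ x * Φ (1 / x) := by
  obtain ⟨a, ha⟩ := eventually_atTop.1 (hΦ.eventually_gt_atTop M)
  -- This threshold ensures both `1/x > a` and `x < 1`.
  refine ⟨1 / (|a| + 1), by positivity, fun x hx0 hx => ?_⟩
  have h1 : |a| + 1 < 1 / x := by
    rw [lt_div_iff₀ hx0]
    rw [lt_div_iff₀ (by positivity)] at hx
    linarith
  have hx1 : x < 1 := hx.trans_le ((div_le_one (by positivity)).2 (by linarith [abs_nonneg a]))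
  rw [gauge_mul_eq Φ hx0 hx1]
  exact ha _ (by linarith [le_abs_self a])

/-- A lower bound for the gauge on a part of the collection bounds the cardinality of this part. -/
lemma encard_mul_le_gaugeSum (Φ : ℝ → ℝ) {C D : Set (Set ℝ)} (hDC : D ⊆ C) (m : ℝ)
    (hm : ∀ I ∈ D, m ≤ gauge Φ (length I).toReal) :
    ((D.encard : ℕ∞) : ℝ≥0∞) * ENNReal.ofReal m ≤ gaugeSum Φ C := by
  calc ((D.encard : ℕ∞) : ℝ≥0∞) * ENNReal.ofReal m = ∑' _ : D, ENNReal.ofReal m := by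
        rw [ENNReal.tsum_const]; rfl
    _ ≤ ∑' I : D, ENNReal.ofReal (gauge Φ (length (I : Set ℝ)).toReal) :=
        ENNReal.tsum_le_tsum fun I => ENNReal.ofReal_le_ofReal (hm I I.2)
    _ ≤ gaugeSum Φ C :=
        ENNReal.tsum_mono_subtype (fun I => ENNReal.ofReal (gauge Φ (length I).toReal)) hDC

end Gauge

end SubordinatorRange

/-! ### Comparison of the two counts. -/

theorem mainTheorem4 {Ω : Type*} [MeasurableSpace Ω] (P : Measure Ω) [IsProbabilityMeasure P]
    (X : ℝ≥0 → Ω → ℝ) (hX : SubordinatorRange.IsSubordinator X P)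
    (hΦ : Tendsto
      (fun x : ℝ => SubordinatorRange.laplaceExponent X P x * Real.log (Real.log x) /
        SubordinatorRange.laplaceExponent X P (x * Real.log (Real.log x))) atTop atTop) :
    ∀ᵐ ω ∂P, ∀ A : ℝ → Set (Set ℝ),
      (∀ δ ∈ Set.Ioo (0 : ℝ) 1,
        SubordinatorRange.IsIntervalCover (A δ) (SubordinatorRange.rangeUpTo X 1 ω) ∧
        ∀ I ∈ A δ, SubordinatorRange.length I < ENNReal.ofReal δ) →
      limsup (fun δ => SubordinatorRange.gaugeSum (SubordinatorRange.laplaceExponent X P) (A δ))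
        (𝓝[>] (0 : ℝ)) < ⊤ →
      ∀ c ∈ Set.Ioo (0 : ℝ) 1,
        Tendsto (fun δ : ℝ =>
          (({I ∈ A δ | ENNReal.ofReal (c * δ) < SubordinatorRange.length I}.encard : ℕ∞) : ℝ≥0∞) /
            ((SubordinatorRange.N X 1 δ ω : ℕ∞) : ℝ≥0∞))
          (𝓝[>] (0 : ℝ)) (𝓝 0) := by
  have hnn := fun x : ℝ => hX.laplaceExponent_nonneg (x := x)
  -- The exceptional null set comes from the bound on `N` alone; the rest is deterministic, so `A`
  -- may depend on the path.
  filter_upwards [hX.ae_exists_le_N] with ω hω A hA hlim c hc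
  obtain ⟨κ, hκ, hN⟩ := hω
  obtain ⟨K, hK, hKtop⟩ := exists_between hlim
  have hKev := eventually_lt_of_limsup_lt hK
  have hK0 : 0 ≤ K.toReal := ENNReal.toReal_nonneg
  have hc0 : 0 < c := hc.1
  rw [ENNReal.tendsto_nhds_zero]
  intro ε hε
  obtain ⟨e, he0, heε⟩ := ENNReal.lt_iff_exists_nnreal_btwn.1 hε
  have he : (0 : ℝ) < e := by exact_mod_cast he0
  -- Chosen so that `(K + 1) / (M c)` equals `e κ`; the `+ 1` keeps `M` positive when `K = 0`.
  set M : ℝ := (K.toReal + 1) / (c * κ * e) with hM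
  have hM0 : 0 < M := by positivity
  obtain ⟨η, hη, hgauge⟩ := SubordinatorRange.eventually_lt_gauge_mul hΦ M
  have hsmall : Set.Ioo (0 : ℝ) (min η 1) ∈ 𝓝[>] (0 : ℝ) := Ioo_mem_nhdsGT (by positivity)
  filter_upwards [hN, hKev, hsmall] with δ hNδ hKδ hδ
  have hδ0 : 0 < δ := hδ.1
  have hδη : δ < η := hδ.2.trans_le (min_le_left _ _)
  have hδ1 : δ < 1 := hδ.2.trans_le (min_le_right _ _)
  set v := SubordinatorRange.laplaceExponent X P (1 / δ) with hv
  -- If `Φ(1/δ)` vanished, the product `f(δ) Φ(1/δ)` could not exceed `M > 0`.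
  have hv0 : 0 < v := by
    have hlt : M < SubordinatorRange.gauge (SubordinatorRange.laplaceExponent X P) δ * v :=
      hgauge δ hδ0 hδη
    refine (hnn (1 / δ) (by positivity)).lt_of_ne fun h => ?_
    rw [hv, ← h, mul_zero] at hlt
    exact hM0.not_gt hlt
  have hcount := SubordinatorRange.encard_mul_le_gaugeSum
    (SubordinatorRange.laplaceExponent X P)
    (Set.sep_subset (A δ) fun I => ENNReal.ofReal (c * δ) < SubordinatorRange.length I)
    (M * c / v) (by
      rintro I ⟨hIA, hI⟩
      have hIδ := (hA δ ⟨hδ0, hδ1⟩).2 I hIA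
      have hItop : SubordinatorRange.length I ≠ ⊤ := hIδ.ne_top
      set x := (SubordinatorRange.length I).toReal with hx
      have hxc : c * δ < x := (ENNReal.ofReal_lt_iff_lt_toReal (by positivity) hItop).1 hI
      have hxδ : x < δ := ENNReal.toReal_lt_of_lt_ofReal hIδ
      have hx0 : 0 < x := lt_trans (by positivity) hxc
      have hg := hgauge x hx0 (hxδ.trans hδη)
      set u := SubordinatorRange.laplaceExponent X P (1 / x) with hu
      have hu0 : 0 < u := by
        refine (hnn (1 / x) (by positivity)).lt_of_ne fun h => ?_
        rw [hu, ← h, mul_zero] at hg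
        exact hM0.not_gt hg
      -- Monotonicity replaces `x` by `cδ`; Jensen with ratio `1/c` then returns to scale `δ`.
      have huv : u ≤ v / c := by
        calc u ≤ SubordinatorRange.laplaceExponent X P (1 / c * (1 / δ)) := by
              refine hX.laplaceExponent_mono (by positivity) ?_
              rw [one_div_mul_one_div]
              exact one_div_le_one_div_of_le (by positivity) hxc.le
          _ ≤ 1 / c * v :=
              hX.laplaceExponent_mul_le (by positivity) ((one_le_div hc0).2 hc.2.le)
          _ = v / c := by rw [one_div_mul_eq_div]
      rw [le_div_iff₀ hc0] at huv
      rw [div_le_iff₀ hv0]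
      have hg0 : 0 < SubordinatorRange.gauge (SubordinatorRange.laplaceExponent X P) x := by
        by_contra! h
        nlinarith
      calc M * c ≤ SubordinatorRange.gauge (SubordinatorRange.laplaceExponent X P) x * u * c := by
            gcongr
        _ = SubordinatorRange.gauge (SubordinatorRange.laplaceExponent X P) x * (u * c) := by ring
        _ ≤ _ := by gcongr)
  refine le_trans ?_ heε.le
  set n := (({I ∈ A δ | ENNReal.ofReal (c * δ) < SubordinatorRange.length I}.encard : ℕ∞) : ℝ≥0∞)
  have hm0 : 0 < M * c / v := by positivity
  have hn : n ≤ ENNReal.ofReal (e * (κ * v)) := by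
    have h1 : n * ENNReal.ofReal (M * c / v) ≤ ENNReal.ofReal (K.toReal + 1) := by
      refine (hcount.trans hKδ.le).trans ?_
      rw [← ENNReal.ofReal_toReal hKtop.ne]
      exact ENNReal.ofReal_le_ofReal (by rw [ENNReal.toReal_ofReal hK0]; linarith)
    rw [← ENNReal.le_div_iff_mul_le (Or.inl (ENNReal.ofReal_pos.2 hm0).ne')
      (Or.inl ENNReal.ofReal_ne_top), ← ENNReal.ofReal_div_of_pos hm0] at h1
    refine h1.trans_eq ?_
    congr 1
    rw [hM]
    field_simp
  refine ENNReal.div_le_of_le_mul (hn.trans ?_)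
  rw [ENNReal.ofReal_mul he.le, ENNReal.ofReal_coe_nnreal]
  gcongr
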